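/- Let $m=2$, and on the index set $\{1,\dots,5\}$ put $i'=6-i$, $\bar\imath=0$ if $i=3$ and $\bar\imath=1$ otherwise, $\theta_1=\theta_2=\theta_3=1$, $\theta_4=\theta_5=-1$, $\kappa=-5/2$. The extended Yangian $\mathrm{X}(\mathfrak{osp}_{1|4})$ is the $\mathbb Z_2$-graded associative unital algebra over $\mathbb C$ generated by elements $t_{ij}^{(r)}$ of parity $\bar\imath+\bar\jmath \bmod 2$ $(1\le i,j\le 5,\ r\ge 1)$, subject to the relations, for the series $t_{ij}(u)=\delta_{ij}+\sum_{r\ge1}t_{ij}^{(r)}u^{-r}$, $$\begin{aligned}{}[t_{ij}(u),t_{kl}(v)]&=\frac{1}{u-v}\big(t_{kj}(u)t_{il}(v)-t_{kj}(v)t_{il}(u)\big)(-1)^{\bar\imath\bar\jmath+\bar\imath\bar k+\bar\jmath\bar k}\\&\quad-\frac{1}{u-v-\kappa}\Big(\delta_{ki'}\sum_{p=1}^{5}t_{pj}(u)t_{p'l}(v)(-1)^{\bar\imath+\bar\imath\bar\jmath+\bar\jmath\bar p}\theta_i\theta_p-\delta_{lj'}\sum_{p=1}^{5}t_{kp'}(v)t_{ip}(u)(-1)^{\bar\imath\bar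 k+\bar\jmath\bar k+\bar\imath\bar p}\theta_{j'}\theta_{p'}\Big),\end{aligned}$$ where $[a,b]=ab-(-1)^{p(a)p(b)}ba$ is the super-commutator of homogeneous elements. Let $T(u)=[t_{ij}(u)]=F(u)H(u)E(u)$ be the unique factorization with $F(u)$ lower unitriangular, $H(u)$ diagonal and $E(u)=[e_{ij}(u)]$ upper unitriangular, and write $e_{ij}(u)=\sum_{r\ge1}e_{ij}^{(r)}u^{-r}$ for $i<j$. Then in $\mathrm{X}(\mathfrak{osp}_{1|4})$ (as identities of formal power series in $v^{-1}$, respectively in $u^{-1},v^{-1}$, where $g(v-3/2)$ is expanded in powers of $v^{-1}$) $$[e_{12}^{(1)},e_{22'}(v)]=e_{12}(v)e_{22'}(v)-e_{12'}(v)-e_{12'}(v-\tfrac32)+e_{23}(v)e_{13}(v-\tfrac32)+e_{22'}(v)e_{12}(v-\tfrac32)$$ and $$\begin{aligned}{}[e_{12}(u),e_{22'}(v)]&=-\frac{e_{12}(u)-e_{12}(v)}{u-v}\,e_{22'}(v)+\frac{e_{12'}(u)-e_{12'}(v)}{u-v}+\frac{e_{12'}(u)-e_{12'}(v-\frac32)}{u-v+\frac32}\\&\quad-e_{23}(v)\frac{e_{13}(u)-e_{13}(v-\frac32)}{u-v+\frac32}-e_{22'}(v)\frac{e_{12}(u)-e_{12}(v-\frac32)}{u-v+\frac32}.\end{aligned}$$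 -/

import Mathlib

open PowerSeries

noncomputable section

namespace OspYangian

/-! ### Formal series in `u⁻¹` and in `u⁻¹, v⁻¹`

A series in `u⁻¹` with coefficients in `A` is an element of `A⟦X⟧`, the variable `X` standing for
`u⁻¹`.  A series in `u⁻¹, v⁻¹` is an element of `A⟦X⟧⟦X⟧`: the coefficient of `u⁻ʳ v⁻ˢ` in `f` is
`coeff s (coeff r f)`, so the outer variable is `u⁻¹` and the inner one is `v⁻¹`. -/

section Series

variable {A : Type*} [Ring A] [Algebra ℂ A]

/-- `g(u)`, as a series in `u⁻¹, v⁻¹`. -/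
def atU (g : A⟦X⟧) : A⟦X⟧⟦X⟧ := PowerSeries.map (C : A →+* A⟦X⟧) g

/-- `g(v)`, as a series in `u⁻¹, v⁻¹`. -/
def atV (g : A⟦X⟧) : A⟦X⟧⟦X⟧ := C g

/-- The monomial `u⁻¹ v⁻¹`. -/
def monUV (A : Type*) [Ring A] : A⟦X⟧⟦X⟧ := X * C X

/-- `u⁻¹ v⁻¹ (u - v - c) = v⁻¹ - u⁻¹ - c u⁻¹ v⁻¹`. -/
def linUV (A : Type*) [Ring A] [Algebra ℂ A] (c : ℂ) : A⟦X⟧⟦X⟧ :=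
  C X - X - c • monUV A

/-- The expansion `u⁻¹ / (1 + c u⁻¹)` of `(u + c)⁻¹` as a series in `u⁻¹`. -/
def shiftVar (c : ℂ) : ℂ⟦X⟧ := X * (1 + c • X)⁻¹

/-- The series `g(u + c) = ∑ᵣ gᵣ (u + c)⁻ʳ`, re-expanded in powers of `u⁻¹`.  The series
`(u + c)⁻ʳ` only contributes to the coefficients of `u⁻ⁿ` with `n ≥ r`. -/
def shift (c : ℂ) (g : A⟦X⟧) : A⟦X⟧ :=
  PowerSeries.mk fun n => ∑ r ∈ Finset.range (n + 1), coeff n (shiftVar c ^ r) • coeff r g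

/-- The series `(g(u) - g(v)) / (u - v) = - ∑_{r, s ≥ 1} g_{r+s-1} u⁻ʳ v⁻ˢ`. -/
def divDiff₀ (g : A⟦X⟧) : A⟦X⟧⟦X⟧ :=
  PowerSeries.mk fun r => PowerSeries.mk fun s =>
    if r = 0 ∨ s = 0 then 0 else - coeff (r + s - 1) g

/-- The series `(g(u) - g(v + c)) / (u - v - c)` in `u⁻¹, v⁻¹`: the replacement of `v` by `v + c`
in the previous series.  It is characterized by the identity proved in `linUV_mul_divDiff`. -/
def divDiff (c : ℂ) (g : A⟦X⟧) : A⟦X⟧⟦X⟧ :=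
  PowerSeries.mk fun r => shift c (coeff r (divDiff₀ g))

theorem shiftVar_mul (c : ℂ) : (1 + c • X) * shiftVar c = (X : ℂ⟦X⟧) := by
  have h : constantCoeff (1 + c • X : ℂ⟦X⟧) ≠ 0 := by simp
  rw [shiftVar, mul_left_comm, PowerSeries.mul_inv_cancel _ h, mul_one]

theorem coeff_shiftVar_pow_of_lt (c : ℂ) {n r : ℕ} (h : n < r) : coeff n (shiftVar c ^ r) = 0 := by
  rw [shiftVar, mul_pow, coeff_X_pow_mul', if_neg (by omega)]

theorem X_mul_shift (c : ℂ) (g : A⟦X⟧) :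
    X * shift c g = (1 + c • X) * shift c (X * g) := by
  have key : ∀ n, coeff n (shift c (X * g)) =
      ∑ r ∈ Finset.range n, coeff n (shiftVar c ^ (r + 1)) • coeff r g := by
    intro n
    rw [shift, coeff_mk, Finset.sum_range_succ']
    simp [coeff_succ_X_mul]
  ext n
  cases n with
  | zero =>
    have h0 := key 0
    simp only [coeff_zero_eq_constantCoeff, Finset.range_zero, Finset.sum_empty] at h0
    simp [add_mul, h0]
  | succ k =>
    rw [coeff_succ_X_mul, add_mul, one_mul, smul_mul_assoc, map_add, key, coeff_smul,
      coeff_succ_X_mul, key, shift, coeff_mk]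
    have h2 : ∑ r ∈ Finset.range k, coeff k (shiftVar c ^ (r + 1)) • coeff r g =
        ∑ r ∈ Finset.range (k + 1), coeff k (shiftVar c ^ (r + 1)) • coeff r g := by
      rw [Finset.sum_range_succ, coeff_shiftVar_pow_of_lt c (Nat.lt_succ_self k), zero_smul,
        add_zero]
    rw [h2, Finset.smul_sum, ← Finset.sum_add_distrib]
    refine Finset.sum_congr rfl fun r _ => ?_
    rw [smul_smul, ← add_smul]
    congr 1
    have h3 : X * shiftVar c ^ r = (1 + c • X) * shiftVar c ^ (r + 1) := by
      rw [pow_succ', ← mul_assoc, shiftVar_mul]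
    have h4 := congrArg (coeff (k + 1)) h3
    rw [coeff_succ_X_mul, add_mul, one_mul, smul_mul_assoc, map_add, coeff_smul,
      coeff_succ_X_mul] at h4
    exact h4

theorem shift_add (c : ℂ) (f g : A⟦X⟧) : shift c (f + g) = shift c f + shift c g := by
  ext n
  simp [shift, Finset.sum_add_distrib]

theorem shift_C (c : ℂ) (a : A) : shift c (C a) = C a := by
  ext n
  rw [shift, coeff_mk, Finset.sum_range_succ']
  simp only [pow_zero, coeff_C, coeff_one]
  by_cases h : n = 0 <;> simp [h]

theorem shift_zero (c : ℂ) : shift c (0 : A⟦X⟧) = 0 := by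
  ext n
  simp [shift]

/-- `(u - v - c) · divDiff c g = g(u) - g(v + c)`, multiplied by `u⁻¹ v⁻¹`. -/
theorem linUV_mul_divDiff (c : ℂ) (g : A⟦X⟧) :
    linUV A c * divDiff c g = monUV A * (atU g - atV (shift c g)) := by
  have hd : ∀ k, X * coeff (k + 1) (divDiff₀ g) + (if k = 0 then X * g else 0) =
      coeff k (divDiff₀ g) + X * C (coeff k g) := by
    intro k
    ext s
    rcases s with _ | s
    · rcases k with _ | k <;> simp [divDiff₀]
    · rcases k with _ | k
      · rcases s with _ | s
        · simp [divDiff₀, coeff_succ_X_mul]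
        · simp [divDiff₀, coeff_succ_X_mul, coeff_X]
      · rcases s with _ | s
        · simp [divDiff₀, coeff_succ_X_mul]
        · simp [divDiff₀, coeff_succ_X_mul, coeff_X,
            show k + 1 + (s + 1) = k + (s + 1 + 1) by omega]
  have hm : ∀ f : A⟦X⟧⟦X⟧, monUV A * f = X * (C X * f) := fun f => by rw [monUV, mul_assoc]
  have hl : ∀ f : A⟦X⟧⟦X⟧, linUV A c * f = C X * f - X * f - X * (c • (C X * f)) := fun f => by
    rw [linUV, sub_mul, sub_mul, smul_mul_assoc, hm, mul_smul_comm]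
  ext1 r
  rw [hl, hm]
  rcases r with _ | k
  · have h0 : coeff 0 (divDiff₀ g) = 0 := by
      ext s
      simp [divDiff₀]
    have h1 : coeff 0 (divDiff c g) = 0 := by rw [divDiff, coeff_mk, h0, shift_zero]
    simp only [map_sub, coeff_C_mul, coeff_zero_X_mul, h1, mul_zero, sub_zero]
  · simp only [map_sub, coeff_C_mul, coeff_succ_X_mul]
    have e1 : coeff k (c • (C X * divDiff c g)) = c • (X * coeff k (divDiff c g)) := by
      rw [← coeff_C_mul]
      rfl
    have e2 : coeff k (atU g) = C (coeff k g) := by rw [atU, coeff_map]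
    have e3 : coeff k (atV (shift c g)) = if k = 0 then shift c g else 0 := by
      rw [atV, coeff_C]
    have e4 : ∀ k, coeff k (divDiff c g) = shift c (coeff k (divDiff₀ g)) := fun k => by
      rw [divDiff, coeff_mk]
    have e5 := congrArg (fun f => (1 + c • X) * shift c f) (hd k)
    simp only [shift_add, mul_add, ← X_mul_shift, shift_C] at e5
    have e6 : (1 + c • X) * shift c (if k = 0 then X * g else 0) =
        X * (if k = 0 then shift c g else 0) := by
      split_ifs
      · rw [X_mul_shift]
      · rw [shift_zero, mul_zero, mul_zero]
    rw [e6, add_mul, one_mul, smul_mul_assoc] at e5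
    rw [e1, e2, e3, e4, e4, mul_sub, sub_sub, sub_eq_sub_iff_add_eq_add, e5]
    abel

end Series

section Maps

variable {A B : Type*} [Ring A] [Algebra ℂ A] [Ring B] [Algebra ℂ B] (φ : A →ₐ[ℂ] B)

theorem map_atU (g : A⟦X⟧) :
    PowerSeries.map (PowerSeries.map (φ : A →+* B)) (atU g) =
      atU (PowerSeries.map (φ : A →+* B) g) := by
  ext r s
  simp [atU]

theorem map_atV (g : A⟦X⟧) :
    PowerSeries.map (PowerSeries.map (φ : A →+* B)) (atV g) =
      atV (PowerSeries.map (φ : A →+* B) g) := by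
  simp [atV]

theorem map_monUV :
    PowerSeries.map (PowerSeries.map (φ : A →+* B)) (monUV A) = monUV B := by
  simp [monUV]

theorem map_linUV (c : ℂ) :
    PowerSeries.map (PowerSeries.map (φ : A →+* B)) (linUV A c) = linUV B c := by
  have h : PowerSeries.map (PowerSeries.map (φ : A →+* B)) (c • monUV A) = c • monUV B := by
    rw [← map_monUV φ]
    ext r s
    simp only [coeff_map]
    exact map_smul φ c _
  simp [linUV, h]

end Maps

theorem atU_zsmul {A : Type*} [Ring A] (z : ℤ) (g : A⟦X⟧) : atU (z • g) = z • atU g := map_zsmul _ _ _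

theorem atV_zsmul {A : Type*} [Ring A] (z : ℤ) (g : A⟦X⟧) : atV (z • g) = z • atV g := map_zsmul _ _ _

theorem coeff_zsmul' {A : Type*} [Ring A] (z : ℤ) (g : A⟦X⟧) (n : ℕ) : z • coeff n g = coeff n (z • g) :=
  (map_zsmul _ _ _).symm

/-! ### The extended Yangian -/

section Yangian

/-- The parity `ī` of the index `i`.  The indices `1, …, 2m+1` are numbered from `0` here, and the
involution `i ↦ i'` is `Fin.rev`. -/
def bar (m : ℕ) (i : Fin (2 * m + 1)) : ℕ := if i.val = m then 0 else 1

/-- The sign `θ_i`. -/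
def theta (m : ℕ) (i : Fin (2 * m + 1)) : ℤ := if i.val ≤ m then 1 else -1

/-- The parameter `κ = -m - 1/2`. -/
def kappa (m : ℕ) : ℂ := -(m : ℂ) - 1 / 2

variable {A : Type*} [Ring A] [Algebra ℂ A]

/-- The left hand side
`(u-v) (u-v-κ) [t_ij(u), t_kl(v)]`, multiplied by `u⁻² v⁻²`, of the defining relations. -/
def relLHS (m : ℕ) (t : Fin (2 * m + 1) → Fin (2 * m + 1) → A⟦X⟧) (i j k l : Fin (2 * m + 1)) :
    A⟦X⟧⟦X⟧ :=
  linUV A 0 * linUV A (kappa m) *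
    (atU (t i j) * atV (t k l) -
      ((-1 : ℤ) ^ ((bar m i + bar m j) * (bar m k + bar m l))) • (atV (t k l) * atU (t i j)))

/-- The right hand side of the defining relations,
`(u-v-κ) (t_kj(u) t_il(v) - t_kj(v) t_il(u)) (-1)^{īj̄ + īk̄ + j̄k̄}`
`- (u-v) (δ_{k i'} ∑_p t_pj(u) t_p'l(v) (-1)^{ī + īj̄ + j̄p̄} θ_i θ_p`
`- δ_{l j'} ∑_p t_kp'(v) t_ip(u) (-1)^{īk̄ + j̄k̄ + īp̄} θ_j' θ_p')`,
multiplied by `u⁻² v⁻²`. -/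
def relRHS (m : ℕ) (t : Fin (2 * m + 1) → Fin (2 * m + 1) → A⟦X⟧) (i j k l : Fin (2 * m + 1)) :
    A⟦X⟧⟦X⟧ :=
  monUV A * linUV A (kappa m) *
      (((-1 : ℤ) ^ (bar m i * bar m j + bar m i * bar m k + bar m j * bar m k)) •
        (atU (t k j) * atV (t i l) - atV (t k j) * atU (t i l))) -
    monUV A * linUV A 0 *
      ((if k = i.rev then
          ∑ p, ((-1 : ℤ) ^ (bar m i + bar m i * bar m j + bar m j * bar m p) *
            theta m i * theta m p) • (atU (t p j) * atV (t p.rev l))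
        else 0) -
       (if l = j.rev then
          ∑ p, ((-1 : ℤ) ^ (bar m i * bar m k + bar m j * bar m k + bar m i * bar m p) *
            theta m j.rev * theta m p.rev) • (atV (t k p.rev) * atU (t i p))
        else 0))

/-- The free algebra on symbols `(i, j, r)`; the symbol `(i, j, r)` stands for `t_ij^{(r+1)}`. -/
abbrev FreeT (m : ℕ) : Type := FreeAlgebra ℂ (Fin (2 * m + 1) × Fin (2 * m + 1) × ℕ)

/-- The series `δ_ij + ∑_{r ≥ 1} t_ij^{(r)} u⁻ʳ` over the free algebra. -/
def freeT (m : ℕ) (i j : Fin (2 * m + 1)) : (FreeT m)⟦X⟧ :=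
  PowerSeries.mk fun r =>
    match r with
    | 0 => if i = j then 1 else 0
    | r + 1 => FreeAlgebra.ι ℂ (i, j, r)

/-- The defining relations: equality of all coefficients on both sides. -/
inductive Rel (m : ℕ) : FreeT m → FreeT m → Prop
  | mk (i j k l : Fin (2 * m + 1)) (r s : ℕ) :
      Rel m (coeff s (coeff r (relLHS m (freeT m) i j k l)))
        (coeff s (coeff r (relRHS m (freeT m) i j k l)))

/-- The extended Yangian `X(osp_{1|2m})`. -/
abbrev XOsp (m : ℕ) : Type := RingQuot (Rel m)

/-- The quotient map from the free algebra. -/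
def proj (m : ℕ) : FreeT m →ₐ[ℂ] XOsp m := RingQuot.mkAlgHom ℂ (Rel m)

/-- The series `t_ij(u)` over `X(osp_{1|2m})`. -/
def tSer (m : ℕ) (i j : Fin (2 * m + 1)) : (XOsp m)⟦X⟧ :=
  PowerSeries.map (proj m : FreeT m →+* XOsp m) (freeT m i j)

/-- The generator matrix `T(u)`. -/
def tMat (m : ℕ) : Matrix (Fin (2 * m + 1)) (Fin (2 * m + 1)) (XOsp m)⟦X⟧ :=
  Matrix.of (tSer m)

end Yangian

/-! ### The `ℤ/2`-grading and the super-commutator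

The grading on `X(osp_{1|2m})`, in which `t_ij^{(r)}` has parity `ī + j̄`, is encoded by its
parity automorphism, equal to `(-1)^p` on the component of parity `p`. -/

section Grading

variable (m : ℕ)

/-- The map `t_ij^{(r)} ↦ (-1)^{ī + j̄} t_ij^{(r)}` from the free algebra to `X(osp_{1|2m})`. -/
def preParity : FreeT m →ₐ[ℂ] XOsp m :=
  FreeAlgebra.lift ℂ fun x =>
    ((-1 : ℤ) ^ (bar m x.1 + bar m x.2.1)) • proj m (FreeAlgebra.ι ℂ x)

theorem bar_rev (i : Fin (2 * m + 1)) : bar m i.rev = bar m i := by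
  have hi := i.isLt
  have h : i.rev.val = m ↔ i.val = m := by
    rw [Fin.val_rev]
    omega
  simp only [bar, h]

theorem relLHS_map {A B : Type*} [Ring A] [Algebra ℂ A] [Ring B] [Algebra ℂ B] (φ : A →ₐ[ℂ] B)
    (t : Fin (2 * m + 1) → Fin (2 * m + 1) → A⟦X⟧) (i j k l : Fin (2 * m + 1)) :
    PowerSeries.map (PowerSeries.map (φ : A →+* B)) (relLHS m t i j k l) =
      relLHS m (fun i j => PowerSeries.map (φ : A →+* B) (t i j)) i j k l := by
  simp only [relLHS, map_mul, map_sub, map_zsmul, map_atU, map_atV, map_linUV]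

theorem relRHS_map {A B : Type*} [Ring A] [Algebra ℂ A] [Ring B] [Algebra ℂ B] (φ : A →ₐ[ℂ] B)
    (t : Fin (2 * m + 1) → Fin (2 * m + 1) → A⟦X⟧) (i j k l : Fin (2 * m + 1)) :
    PowerSeries.map (PowerSeries.map (φ : A →+* B)) (relRHS m t i j k l) =
      relRHS m (fun i j => PowerSeries.map (φ : A →+* B) (t i j)) i j k l := by
  simp only [relRHS, map_mul, map_sub, map_zsmul, map_atU, map_atV, map_linUV, map_monUV,
    apply_ite (PowerSeries.map (PowerSeries.map (φ : A →+* B))), map_sum, map_zero]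

theorem relLHS_twist {A : Type*} [Ring A] [Algebra ℂ A]
    (t : Fin (2 * m + 1) → Fin (2 * m + 1) → A⟦X⟧) (i j k l : Fin (2 * m + 1)) :
    relLHS m (fun i j => ((-1 : ℤ) ^ (bar m i + bar m j)) • t i j) i j k l =
      ((-1 : ℤ) ^ (bar m i + bar m j + bar m k + bar m l)) • relLHS m t i j k l := by
  simp only [relLHS, atU_zsmul, atV_zsmul, smul_mul_assoc, smul_smul, ← pow_add, ← mul_smul_comm,
    smul_sub]
  congr 3
  · ring_nf
  · ring_nf

theorem sign_rev (i j l p : Fin (2 * m + 1)) :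
    (-1 : ℤ) ^ (bar m p + bar m j) * (-1 : ℤ) ^ (bar m p.rev + bar m l) =
      (-1 : ℤ) ^ (bar m i + bar m j + bar m i.rev + bar m l) := by
  rw [bar_rev, bar_rev, ← pow_add,
    show bar m p + bar m j + (bar m p + bar m l) = 2 * bar m p + (bar m j + bar m l) by ring,
    show bar m i + bar m j + bar m i + bar m l = 2 * bar m i + (bar m j + bar m l) by ring,
    pow_add _ (2 * bar m p), pow_add _ (2 * bar m i), pow_mul, pow_mul, neg_one_sq, one_pow,
    one_pow]

theorem relRHS_twist {A : Type*} [Ring A] [Algebra ℂ A]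
    (t : Fin (2 * m + 1) → Fin (2 * m + 1) → A⟦X⟧) (i j k l : Fin (2 * m + 1)) :
    relRHS m (fun i j => ((-1 : ℤ) ^ (bar m i + bar m j)) • t i j) i j k l =
      ((-1 : ℤ) ^ (bar m i + bar m j + bar m k + bar m l)) • relRHS m t i j k l := by
  have uv : ∀ (a b : ℤ) (x y : A⟦X⟧), atU (a • x) * atV (b • y) = (a * b) • (atU x * atV y) := by
    intro a b x y
    rw [atU_zsmul, atV_zsmul, smul_mul_smul_comm]
  have vu : ∀ (a b : ℤ) (x y : A⟦X⟧), atV (a • x) * atU (b • y) = (a * b) • (atV x * atU y) := by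
    intro a b x y
    rw [atU_zsmul, atV_zsmul, smul_mul_smul_comm]
  have s1 : (-1 : ℤ) ^ (bar m k + bar m j) * (-1 : ℤ) ^ (bar m i + bar m l) =
      (-1 : ℤ) ^ (bar m i + bar m j + bar m k + bar m l) := by
    rw [← pow_add]
    congr 1
    ring
  simp only [relRHS, uv, vu, s1]
  set ε : ℤ := (-1 : ℤ) ^ (bar m i + bar m j + bar m k + bar m l) with hε
  have q1 : (if k = i.rev then
        ∑ p, ((-1 : ℤ) ^ (bar m i + bar m i * bar m j + bar m j * bar m p) *
          theta m i * theta m p) • ((-1 : ℤ) ^ (bar m p + bar m j) *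
            (-1 : ℤ) ^ (bar m p.rev + bar m l)) • (atU (t p j) * atV (t p.rev l)) else 0) =
      ε • (if k = i.rev then
        ∑ p, ((-1 : ℤ) ^ (bar m i + bar m i * bar m j + bar m j * bar m p) *
          theta m i * theta m p) • (atU (t p j) * atV (t p.rev l)) else 0) := by
    split_ifs with h
    · subst h
      rw [Finset.smul_sum]
      refine Finset.sum_congr rfl fun p _ => ?_
      rw [sign_rev m i, smul_comm]
    · rw [smul_zero]
  have q2 : (if l = j.rev then
        ∑ p, ((-1 : ℤ) ^ (bar m i * bar m k + bar m j * bar m k + bar m i * bar m p) *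
          theta m j.rev * theta m p.rev) • ((-1 : ℤ) ^ (bar m k + bar m p.rev) *
            (-1 : ℤ) ^ (bar m i + bar m p)) • (atV (t k p.rev) * atU (t i p)) else 0) =
      ε • (if l = j.rev then
        ∑ p, ((-1 : ℤ) ^ (bar m i * bar m k + bar m j * bar m k + bar m i * bar m p) *
          theta m j.rev * theta m p.rev) • (atV (t k p.rev) * atU (t i p)) else 0) := by
    split_ifs with h
    · subst h
      rw [Finset.smul_sum]
      refine Finset.sum_congr rfl fun p _ => ?_
      have h3 : (-1 : ℤ) ^ (bar m k + bar m p.rev) * (-1 : ℤ) ^ (bar m i + bar m p) = ε := by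
        have h4 := sign_rev m j i k p
        rw [hε, mul_comm, add_comm (bar m i), add_comm (bar m k), h4]
        congr 1
        ring
      rw [h3, smul_comm]
    · rw [smul_zero]
  rw [q1, q2, ← smul_sub, ← smul_sub, smul_comm _ ε,
    mul_smul_comm ε (monUV A * linUV A (kappa m)), mul_smul_comm ε (monUV A * linUV A 0), ← smul_sub]

theorem relLHS_tSer (i j k l : Fin (2 * m + 1)) :
    relLHS m (tSer m) i j k l = relRHS m (tSer m) i j k l := by
  have h : PowerSeries.map (PowerSeries.map (proj m : FreeT m →+* XOsp m))
      (relLHS m (freeT m) i j k l) = PowerSeries.map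
      (PowerSeries.map (proj m : FreeT m →+* XOsp m)) (relRHS m (freeT m) i j k l) := by
    ext r s
    simp only [coeff_map]
    exact RingQuot.mkAlgHom_rel ℂ (Rel.mk i j k l r s)
  rw [relLHS_map, relRHS_map] at h
  exact h

theorem map_preParity_freeT (i j : Fin (2 * m + 1)) :
    PowerSeries.map (preParity m : FreeT m →+* XOsp m) (freeT m i j) =
      ((-1 : ℤ) ^ (bar m i + bar m j)) • tSer m i j := by
  ext r
  rw [← coeff_zsmul', coeff_map, tSer, coeff_map]
  rcases r with _ | r
  · by_cases h : i = j
    · subst h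
      simp [freeT, ← two_mul, pow_mul]
    · simp [freeT, h]
  · simp [freeT, preParity]

theorem preParity_rel ⦃a b : FreeT m⦄ (h : Rel m a b) : preParity m a = preParity m b := by
  obtain ⟨i, j, k, l, r, s⟩ := h
  have h : PowerSeries.map (PowerSeries.map (preParity m : FreeT m →+* XOsp m))
      (relLHS m (freeT m) i j k l) = PowerSeries.map
      (PowerSeries.map (preParity m : FreeT m →+* XOsp m)) (relRHS m (freeT m) i j k l) := by
    rw [relLHS_map, relRHS_map]
    simp only [map_preParity_freeT]
    rw [relLHS_twist, relRHS_twist, relLHS_tSer]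
  have h2 := congrArg (fun f => coeff s (coeff r f)) h
  simp only [coeff_map] at h2
  exact h2

/-- The parity automorphism of `X(osp_{1|2m})`. -/
def parity : XOsp m →ₐ[ℂ] XOsp m :=
  RingQuot.liftAlgHom ℂ ⟨preParity m, preParity_rel m⟩

theorem parity_coeff_tSer (i j : Fin (2 * m + 1)) (r : ℕ) :
    parity m (coeff r (tSer m i j)) =
      ((-1 : ℤ) ^ (bar m i + bar m j)) • coeff r (tSer m i j) := by
  have h := congrArg (coeff r) (map_preParity_freeT m i j)
  rw [← coeff_zsmul', coeff_map] at h
  rw [← h, tSer, coeff_map]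
  exact RingQuot.liftAlgHom_mkAlgHom_apply ..

variable {m}

/-- The component of parity `0` of an element. -/
def evenPart (a : XOsp m) : XOsp m := (1 / 2 : ℂ) • (a + parity m a)

/-- The component of parity `1` of an element. -/
def oddPart (a : XOsp m) : XOsp m := (1 / 2 : ℂ) • (a - parity m a)

/-- The super-commutator, i.e. the bilinear extension of
`[a, b] = a b - b a (-1)^{p(a) p(b)}` for homogeneous `a`, `b`. -/
def sbr (a b : XOsp m) : XOsp m := a * b - (b * evenPart a + parity m b * oddPart a)

theorem sbr_of_homogeneous (p q : ℕ) (a b : XOsp m)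
    (ha : parity m a = ((-1 : ℤ) ^ p) • a) (hb : parity m b = ((-1 : ℤ) ^ q) • b) :
    sbr a b = a * b - ((-1 : ℤ) ^ (p * q)) • (b * a) := by
  have h2 : (2⁻¹ : ℂ) • a + (2⁻¹ : ℂ) • a = a := by
    rw [← add_smul]
    norm_num
  rw [sbr, evenPart, oddPart, ha, hb]
  congr 1
  rcases Nat.even_or_odd p with hp | hp
  · simp [hp.neg_one_pow, (hp.mul_right q).neg_one_pow, h2]
  · simp [hp.neg_one_pow, pow_mul, h2, mul_assoc]

/-- `[a, g(v)]`, taken coefficientwise. -/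
def sbrElt (a : XOsp m) (g : (XOsp m)⟦X⟧) : (XOsp m)⟦X⟧ :=
  PowerSeries.mk fun s => sbr a (coeff s g)

/-- `[f(u), g(v)]`, taken coefficientwise. -/
def sbrSer (f g : (XOsp m)⟦X⟧) : (XOsp m)⟦X⟧⟦X⟧ :=
  PowerSeries.mk fun r => sbrElt (coeff r f) g

end Grading

/-! ### The Gauss decomposition -/

section Gauss

variable {A : Type*} [Ring A] {n : ℕ}

/-- `T = F H E` with `F` lower unitriangular, `H = diag(h)` and `E` upper unitriangular. -/
structure IsGauss (T F : Matrix (Fin n) (Fin n) A⟦X⟧) (h : Fin n → A⟦X⟧)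
    (E : Matrix (Fin n) (Fin n) A⟦X⟧) : Prop where
  eq : T = F * Matrix.diagonal h * E
  F_diag : ∀ i, F i i = 1
  F_upper : ∀ i j, i < j → F i j = 0
  E_diag : ∀ i, E i i = 1
  E_lower : ∀ i j, j < i → E i j = 0

/-- The inverse of a series with constant term `1`. -/
def inv1 (g : A⟦X⟧) : A⟦X⟧ := invOfUnit g 1

/-- Gaussian elimination: after `k` steps, the entry `(i, j)` with `i, j ≥ k` (counting from `0`)
is the quasideterminant of the submatrix with rows `0, …, k-1, i` and columns `0, …, k-1, j`,
with respect to its last entry. -/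
def schur (T : Matrix (Fin n) (Fin n) A⟦X⟧) : ℕ → Matrix (Fin n) (Fin n) A⟦X⟧
  | 0 => T
  | k + 1 => Matrix.of fun i j =>
      if hk : k < n then
        schur T k i j - schur T k i ⟨k, hk⟩ * inv1 (schur T k ⟨k, hk⟩ ⟨k, hk⟩) * schur T k ⟨k, hk⟩ j
      else schur T k i j

/-- The series `h_i(u)`. -/
def gaussH (T : Matrix (Fin n) (Fin n) A⟦X⟧) (i : Fin n) : A⟦X⟧ := schur T i i i

/-- The series `e_ij(u)`, `i < j`, as the matrix `E(u)`. -/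
def gaussE (T : Matrix (Fin n) (Fin n) A⟦X⟧) : Matrix (Fin n) (Fin n) A⟦X⟧ :=
  Matrix.of fun i j =>
    if i = j then 1 else if i < j then inv1 (gaussH T i) * schur T i i j else 0

/-- The series `f_ji(u)`, `i < j`, as the matrix `F(u)`. -/
def gaussF (T : Matrix (Fin n) (Fin n) A⟦X⟧) : Matrix (Fin n) (Fin n) A⟦X⟧ :=
  Matrix.of fun j i =>
    if i = j then 1 else if i < j then schur T i j i * inv1 (gaussH T i) else 0

theorem constantCoeff_schur (T : Matrix (Fin n) (Fin n) A⟦X⟧)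
    (hT : ∀ i j, constantCoeff (T i j) = if i = j then 1 else 0) (k : ℕ) (i j : Fin n) :
    constantCoeff (schur T k i j) = if i = j ∧ k ≤ i.val then 1 else 0 := by
  induction k generalizing i j with
  | zero => simp [schur, hT]
  | succ k ih =>
    by_cases hk : k < n
    · simp only [schur, Matrix.of_apply, dif_pos hk, map_sub, map_mul, ih]
      simp only [inv1, constantCoeff_invOfUnit]
      by_cases h : i = j
      · subst h
        by_cases h2 : i = ⟨k, hk⟩
        · subst h2
          simp
        · have h3 : i.val ≠ k := fun h => h2 (Fin.ext h)
          by_cases h4 : k ≤ i.val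
          · simp [h2, h4, show k + 1 ≤ i.val by omega]
          · simp [h2, h4, show ¬ k + 1 ≤ i.val by omega]
      · by_cases h2 : i = ⟨k, hk⟩
        · have h3 : (⟨k, hk⟩ : Fin n) ≠ j := fun h' => h (h2.trans h')
          simp [h, h3]
        · simp [h, h2]
    · have h3 : ¬ k ≤ i.val := by omega
      have h4 : ¬ k + 1 ≤ i.val := by omega
      simp [schur, hk, ih, h3, h4]

theorem constantCoeff_gaussH (T : Matrix (Fin n) (Fin n) A⟦X⟧)
    (hT : ∀ i j, constantCoeff (T i j) = if i = j then 1 else 0) (i : Fin n) :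
    constantCoeff (gaussH T i) = 1 := by
  simp [gaussH, constantCoeff_schur T hT]

theorem mul_inv1 (g : A⟦X⟧) (h : constantCoeff g = 1) : g * inv1 g = 1 :=
  mul_invOfUnit g 1 (by simpa using h)

theorem inv1_mul (g : A⟦X⟧) (h : constantCoeff g = 1) : inv1 g * g = 1 :=
  invOfUnit_mul g 1 (by simpa using h)

theorem schur_succ (T : Matrix (Fin n) (Fin n) A⟦X⟧) (k i j : Fin n) :
    schur T (k.val + 1) i j =
      schur T k i j - schur T k i k * inv1 (schur T k k k) * schur T k k j := by
  simp [schur]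

theorem schur_eq_zero (T : Matrix (Fin n) (Fin n) A⟦X⟧)
    (hT : ∀ i j, constantCoeff (T i j) = if i = j then 1 else 0) (k : ℕ) (i j : Fin n)
    (h : i.val < k ∨ j.val < k) : schur T k i j = 0 := by
  induction k generalizing i j with
  | zero => omega
  | succ k ih =>
    by_cases hk : k < n
    · rw [schur_succ T ⟨k, hk⟩ i j]
      have hc : constantCoeff (schur T k ⟨k, hk⟩ ⟨k, hk⟩) = 1 := constantCoeff_gaussH T hT ⟨k, hk⟩
      by_cases h1 : i.val < k ∨ j.val < k
      · rw [ih i j h1]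
        rcases h1 with h1 | h1
        · rw [ih i ⟨k, hk⟩ (Or.inl h1)]
          simp
        · rw [ih ⟨k, hk⟩ j (Or.inr h1)]
          simp
      · rcases (show i.val = k ∨ j.val = k by omega) with h2 | h2
        · obtain rfl : i = ⟨k, hk⟩ := Fin.ext h2
          rw [mul_inv1 _ hc, one_mul, sub_self]
        · obtain rfl : j = ⟨k, hk⟩ := Fin.ext h2
          rw [mul_assoc, inv1_mul _ hc, mul_one, sub_self]
    · simp only [schur, Matrix.of_apply, dif_neg hk]
      exact ih i j (by omega)

theorem gaussE_lower (T : Matrix (Fin n) (Fin n) A⟦X⟧) {i j : Fin n} (h : j < i) :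
    gaussE T i j = 0 := by
  simp [gaussE, h.ne', h.not_gt]

theorem gaussF_upper (T : Matrix (Fin n) (Fin n) A⟦X⟧) {i j : Fin n} (h : i < j) :
    gaussF T i j = 0 := by
  simp [gaussF, h.ne', h.not_gt]

theorem gaussH_mul_gaussE (T : Matrix (Fin n) (Fin n) A⟦X⟧)
    (hT : ∀ i j, constantCoeff (T i j) = if i = j then 1 else 0) (k j : Fin n) :
    gaussH T k * gaussE T k j = schur T k k j := by
  rcases lt_trichotomy k j with h | h | h
  · simp only [gaussE, Matrix.of_apply, if_neg h.ne, if_pos h]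
    rw [← mul_assoc, mul_inv1 _ (constantCoeff_gaussH T hT k), one_mul]
  · subst h
    simp [gaussE, gaussH]
  · rw [gaussE_lower T h, schur_eq_zero T hT k k j (Or.inr h), mul_zero]

theorem gaussF_mul_gaussH (T : Matrix (Fin n) (Fin n) A⟦X⟧)
    (hT : ∀ i j, constantCoeff (T i j) = if i = j then 1 else 0) (k i : Fin n) :
    gaussF T i k * gaussH T k = schur T k i k := by
  rcases lt_trichotomy k i with h | h | h
  · simp only [gaussF, Matrix.of_apply, if_neg h.ne, if_pos h]
    rw [mul_assoc, inv1_mul _ (constantCoeff_gaussH T hT k), mul_one]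
  · subst h
    simp [gaussF, gaussH]
  · rw [gaussF_upper T h, schur_eq_zero T hT k i k (Or.inl h), zero_mul]

theorem isGauss_apply {T F E : Matrix (Fin n) (Fin n) A⟦X⟧} {h : Fin n → A⟦X⟧}
    (hG : T = F * Matrix.diagonal h * E) (i j : Fin n) :
    T i j = ∑ k, F i k * h k * E k j := by
  rw [hG, Matrix.mul_apply]
  simp only [Matrix.mul_diagonal]

/-- Existence of the Gauss decomposition of a matrix with constant term `1`. -/
theorem isGauss_gauss (T : Matrix (Fin n) (Fin n) A⟦X⟧)
    (hT : ∀ i j, constantCoeff (T i j) = if i = j then 1 else 0) :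
    IsGauss T (gaussF T) (gaussH T) (gaussE T) := by
  refine ⟨?_, fun i => by simp [gaussF], fun i j h => gaussF_upper T h,
    fun i => by simp [gaussE], fun i j h => gaussE_lower T h⟩
  ext1 i j
  rw [Matrix.mul_apply]
  simp only [Matrix.mul_diagonal]
  have hstep : ∀ k : Fin n, gaussF T i k * gaussH T k * gaussE T k j =
      schur T k i j - schur T (k.val + 1) i j := by
    intro k
    have hc := inv1_mul _ (constantCoeff_gaussH T hT k)
    rw [schur_succ, sub_sub_cancel, show schur T k k k = gaussH T k from rfl,
      ← gaussF_mul_gaussH T hT, ← gaussH_mul_gaussE T hT, mul_assoc (gaussF T i k * gaussH T k),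
      ← mul_assoc (inv1 _), hc, one_mul]
  rw [Finset.sum_congr rfl fun k _ => hstep k,
    Fin.sum_univ_eq_sum_range (fun k => schur T k i j - schur T (k + 1) i j) n,
    Finset.sum_range_sub', schur_eq_zero T hT n i j (Or.inl i.isLt), sub_zero]
  rfl

/-- Uniqueness of the Gauss decomposition of a matrix with constant term `1`. -/
theorem IsGauss.unique {T F E : Matrix (Fin n) (Fin n) A⟦X⟧} {h : Fin n → A⟦X⟧}
    (hT : ∀ i j, constantCoeff (T i j) = if i = j then 1 else 0) (hG : IsGauss T F h E) :
    F = gaussF T ∧ h = gaussH T ∧ E = gaussE T := by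
  have row : ∀ (k j : Fin n), (∑ p, if k ≤ p then F k p * h p * E p j else 0) = h k * E k j := by
    intro k j
    rw [Finset.sum_eq_single k]
    · simp [hG.F_diag]
    · intro p _ hp
      split_ifs with hkp
      · rw [hG.F_upper k p (lt_of_le_of_ne hkp hp.symm)]
        simp
      · rfl
    · simp
  have col : ∀ (k i : Fin n), (∑ p, if k ≤ p then F i p * h p * E p k else 0) = F i k * h k := by
    intro k i
    rw [Finset.sum_eq_single k]
    · simp [hG.E_diag]
    · intro p _ hp
      split_ifs with hkp
      · rw [hG.E_lower p k (lt_of_le_of_ne hkp hp.symm)]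
        simp
      · rfl
    · simp
  have main : ∀ k : ℕ, ∀ i j : Fin n,
      schur T k i j = ∑ p : Fin n, if k ≤ p.val then F i p * h p * E p j else 0 := by
    intro k
    induction k with
    | zero =>
      intro i j
      simp only [schur, Nat.zero_le, if_true]
      exact isGauss_apply hG.eq i j
    | succ k ih =>
      intro i j
      by_cases hk : k < n
      · have e1 : ∀ j, schur T k ⟨k, hk⟩ j = h ⟨k, hk⟩ * E ⟨k, hk⟩ j := fun j =>
          (ih _ _).trans (row ⟨k, hk⟩ j)
        have e2 : schur T k i ⟨k, hk⟩ = F i ⟨k, hk⟩ * h ⟨k, hk⟩ := (ih _ _).trans (col ⟨k, hk⟩ i)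
        have e3 : schur T k ⟨k, hk⟩ ⟨k, hk⟩ = h ⟨k, hk⟩ := by rw [e1, hG.E_diag, mul_one]
        have hc : constantCoeff (h ⟨k, hk⟩) = 1 := by
          rw [← e3]
          exact constantCoeff_gaussH T hT ⟨k, hk⟩
        have e4 := schur_succ T ⟨k, hk⟩ i j
        simp only at e4
        rw [e4, e3, e2, e1 j, mul_assoc (F i ⟨k, hk⟩), mul_inv1 _ hc, mul_one, ← mul_assoc, ih,
          sub_eq_iff_eq_add]
        have e5 : ∀ p : Fin n, (if k ≤ p.val then F i p * h p * E p j else 0) =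
            (if k + 1 ≤ p.val then F i p * h p * E p j else 0) +
              (if p = ⟨k, hk⟩ then F i p * h p * E p j else 0) := by
          intro p
          by_cases hp : p = ⟨k, hk⟩
          · subst hp
            simp
          · have : p.val ≠ k := fun h => hp (Fin.ext h)
            by_cases h6 : k ≤ p.val
            · simp [hp, h6, show k + 1 ≤ p.val by omega]
            · simp [hp, h6, show ¬ k + 1 ≤ p.val by omega]
        rw [Finset.sum_congr rfl fun p _ => e5 p, Finset.sum_add_distrib]
        simp
      · simp only [schur, Matrix.of_apply, dif_neg hk]
        rw [ih]
        refine Finset.sum_congr rfl fun p _ => ?_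
        rw [if_neg (by omega), if_neg (by omega)]
  have hrow : ∀ k j : Fin n, schur T k k j = h k * E k j := fun k j => (main _ _ _).trans (row k j)
  have hcol : ∀ k i : Fin n, schur T k i k = F i k * h k := fun k i => (main _ _ _).trans (col k i)
  have hh : ∀ k, h k = gaussH T k := fun k => by rw [gaussH, hrow, hG.E_diag, mul_one]
  refine ⟨?_, funext hh, ?_⟩
  · ext1 i k
    have h1 := (gaussF_mul_gaussH T hT k i).trans (hcol k i)
    rw [hh k] at h1
    have h2 := congrArg (· * inv1 (gaussH T k)) h1
    simp only [mul_assoc, mul_inv1 _ (constantCoeff_gaussH T hT k), mul_one] at h2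
    exact h2.symm
  · ext1 k j
    have h1 := (gaussH_mul_gaussE T hT k j).trans (hrow k j)
    rw [hh k] at h1
    have h2 := congrArg (inv1 (gaussH T k) * ·) h1
    simp only [← mul_assoc, inv1_mul _ (constantCoeff_gaussH T hT k), one_mul] at h2
    exact h2.symm

end Gauss

/-- The series `e_ij(u)` over `X(osp_{1|2m})`; the indices are counted from `0`. -/
def eSer (m : ℕ) (i j : Fin (2 * m + 1)) : (XOsp m)⟦X⟧ := gaussE (tMat m) i j

theorem constantCoeff_tMat (m : ℕ) (i j : Fin (2 * m + 1)) :
    constantCoeff (tMat m i j) = if i = j then 1 else 0 := by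
  rw [← coeff_zero_eq_constantCoeff_apply, tMat, Matrix.of_apply, tSer, coeff_map]
  by_cases h : i = j <;> simp [freeT, h]

end OspYangian

end

open OspYangian

namespace OspYangian

/-! ### Cancellation and divisibility for the central factors `u - v - c` -/

section Regular

variable {A : Type*} [Ring A]

/-! Indices in these comments run from 1 to 5, as in the theorem; the code counts from 0. Write
`s_l(v) = t_2l(v) - t_21(v) t_11(v)⁻¹ t_1l(v)` for the second row after one elimination step. Then
`e_1l = t_11⁻¹ t_1l` and `e_2l = s_2⁻¹ s_l`, so the claim concerns commutators of `t_11(u)`,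
`t_12(u)` with the `s_l(v)`. Both of these series are even, so every super-commutator involved is an
ordinary one.

Combining the defining relations for `t_1l(v)` and `t_2l(v)` as in the quasideterminant
(`commutator_schur`) turns each row `t_k·(v)` on the right into `s_·(v)`. Since `s_1 = 0`, `t_11(u)`
commutes with `s_l(v)` for `l ≠ 5`, while `(u - v - κ) [t_11(u), s_5(v)]` is a sum of terms `s_l(v)
t_1p(u)`. Multiply that identity on the left by `t_11(u)⁻¹`. Moving `t_11(u)` past `s_5(v)`
reproduces the commutator once, which changes `u - v - κ = u - v + 5/2` into `u - v + 3/2`; this is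
the origin of the shift. The right side must vanish at `u = v - 3/2`. This eliminates `s_5(v)` and
leaves divided differences of `e_14`, `e_13`, `e_12` (`inv_mul_commutator_last`).

The sum in the relation for `[t_12(u), s_4(v)]` is the same one, hence may be replaced by `[t_11(u),
s_5(v)]`. This gives `[e_12(u), s_4(v)]`; similarly `[e_12(u), s_2(v)]` is found, and the Leibniz
rule for `s_2⁻¹ s_4` yields the second identity (`commutator_firstRow_secondRow`). The first
identity is its coefficient of `u⁻¹`. -/

theorem atU_mul (f g : A⟦X⟧) : atU (f * g) = atU f * atU g := map_mul _ _ _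

theorem atU_one : atU (1 : A⟦X⟧) = 1 := map_one _

theorem atV_mul (f g : A⟦X⟧) : atV (f * g) = atV f * atV g := map_mul _ _ _

theorem atV_sub (f g : A⟦X⟧) : atV (f - g) = atV f - atV g := map_sub _ _ _

theorem atV_one : atV (1 : A⟦X⟧) = 1 := map_one _

theorem atV_zero : atV (0 : A⟦X⟧) = 0 := map_zero _

theorem C_X_mul_comm (f : A⟦X⟧⟦X⟧) : C X * f = f * C X := by
  ext1 r
  rw [coeff_C_mul, coeff_mul_C, (commute_X (coeff r f)).eq]

theorem X_mul_eq_zero {f : A⟦X⟧} (h : X * f = 0) : f = 0 := by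
  ext n
  simpa [coeff_succ_X_mul] using congrArg (coeff (n + 1)) h

theorem monUV_mul_comm (f : A⟦X⟧⟦X⟧) : monUV A * f = f * monUV A := by
  rw [monUV, mul_assoc, C_X_mul_comm, ← mul_assoc, ← mul_assoc, (commute_X f).eq]

variable [Algebra ℂ A]

theorem linUV_mul_comm (c : ℂ) (f : A⟦X⟧⟦X⟧) : linUV A c * f = f * linUV A c := by
  simp only [linUV, sub_mul, mul_sub, smul_mul_assoc, mul_smul_comm, monUV_mul_comm,
    C_X_mul_comm, (commute_X f).eq]

theorem linUV_sub_monUV (c : ℂ) : linUV A c - monUV A = linUV A (c + 1) := by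
  rw [linUV, linUV, add_smul, one_smul]
  abel

theorem coeff_zero_linUV_mul (c : ℂ) (f : A⟦X⟧⟦X⟧) :
    coeff 0 (linUV A c * f) = X * coeff 0 f := by
  simp only [linUV, monUV, sub_mul, smul_mul_assoc, mul_assoc, map_sub, coeff_C_mul,
    coeff_zero_X_mul, sub_zero]
  rw [← mul_smul_comm, coeff_zero_X_mul, sub_zero]

theorem coeff_succ_linUV_mul (c : ℂ) (f : A⟦X⟧⟦X⟧) (r : ℕ) :
    coeff (r + 1) (linUV A c * f) =
      X * coeff (r + 1) f - (coeff r f + c • (X * coeff r f)) := by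
  have h : coeff r (c • (C X * f)) = c • (X * coeff r f) := by
    rw [← coeff_C_mul]
    rfl
  simp only [linUV, monUV, sub_mul, smul_mul_assoc, mul_assoc, map_sub, coeff_C_mul,
    coeff_succ_X_mul]
  rw [← mul_smul_comm, coeff_succ_X_mul, h, sub_sub]

/-- Order by powers of `u⁻¹`: once the lower coefficients of `f` vanish, the next coefficient of the
product is `v⁻¹` times that of `f`, and `v⁻¹` is not a zero divisor. -/
theorem linUV_mul_eq_zero {c : ℂ} {f : A⟦X⟧⟦X⟧} (h : linUV A c * f = 0) : f = 0 := by
  ext1 r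
  induction r with
  | zero =>
    have h0 := coeff_zero_linUV_mul c f
    rw [h, map_zero] at h0
    exact X_mul_eq_zero h0.symm
  | succ r ih =>
    have h1 := coeff_succ_linUV_mul c f r
    rw [map_zero] at ih
    rw [h, ih, map_zero, mul_zero, smul_zero, add_zero, sub_zero] at h1
    exact X_mul_eq_zero h1.symm

theorem linUV_mul_cancel {c : ℂ} {f g : A⟦X⟧⟦X⟧} (h : linUV A c * f = linUV A c * g) :
    f = g :=
  sub_eq_zero.mp (linUV_mul_eq_zero (by rw [mul_sub, h, sub_self]))

/-- A series in `v⁻¹` is not divisible by `u - v - c` unless it vanishes. -/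
theorem eq_zero_of_linUV_mul_eq {c : ℂ} {f : A⟦X⟧⟦X⟧} {g : A⟦X⟧}
    (h : linUV A c * f = monUV A * atV g) : g = 0 := by
  have hm : monUV A * atV g = X * C (X * g) := by rw [monUV, mul_assoc, atV, map_mul]
  have h0 : coeff 0 f = 0 := by
    have h0 := coeff_zero_linUV_mul c f
    rw [h, hm, coeff_zero_X_mul] at h0
    exact X_mul_eq_zero h0.symm
  have h1 : coeff 1 f = g := by
    have h1 := coeff_succ_linUV_mul c f 0
    rw [h, hm, coeff_succ_X_mul, h0] at h1
    simp only [coeff_zero_eq_constantCoeff, constantCoeff_C, zero_add, mul_zero, smul_zero,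
      sub_zero] at h1
    exact sub_eq_zero.mp (X_mul_eq_zero (by rw [mul_sub, h1, sub_self]))
  have hs : ∀ r, coeff (r + 1) f + c • (X * coeff (r + 1) f) = X * coeff (r + 2) f := by
    intro r
    have h2 := coeff_succ_linUV_mul c f (r + 1)
    rw [h, hm, coeff_succ_X_mul, coeff_C, if_neg (Nat.succ_ne_zero r)] at h2
    exact (sub_eq_zero.mp h2.symm).symm
  -- By `hs`, each coefficient `f_{r+1}` equals `X * (f_{r+2} - c • f_{r+1})`. Hence all of them are
  -- divisible by every power of `X`.
  have key : ∀ n r, coeff n (coeff (r + 1) f) = 0 := by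
    intro n
    induction n with
    | zero =>
      intro r
      have h2 := congrArg (coeff 0) (hs r)
      rw [map_add, coeff_smul, coeff_zero_X_mul, coeff_zero_X_mul, smul_zero, add_zero] at h2
      exact h2
    | succ n ih =>
      intro r
      have h2 := congrArg (coeff (n + 1)) (hs r)
      rw [map_add, coeff_smul, coeff_succ_X_mul, coeff_succ_X_mul, ih, ih, smul_zero,
        add_zero] at h2
      exact h2
  ext n
  rw [← h1, key n 0, map_zero]

theorem shift_zero_left (g : A⟦X⟧) : shift 0 g = g := by
  ext n
  have h : shiftVar 0 = X := by simp [shiftVar]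
  rw [shift, coeff_mk, Finset.sum_range_succ, Finset.sum_eq_zero, zero_add, h, coeff_X_pow_self,
    one_smul]
  intro r hr
  rw [h, coeff_X_pow, if_neg (by have := Finset.mem_range.mp hr; omega), zero_smul]

/-- Used to extract the identity for `e_12^{(1)}` from the two-variable one. -/
theorem coeff_one_divDiff (c : ℂ) {g : A⟦X⟧} (hg : constantCoeff g = 0) :
    coeff 1 (divDiff c g) = -shift c g := by
  have h : coeff 1 (divDiff₀ g) = -g := by
    ext s
    rcases s with _ | s
    · simp [divDiff₀, hg]
    · simp [divDiff₀]
  rw [divDiff, coeff_mk, h, eq_neg_iff_add_eq_zero, ← shift_add, neg_add_cancel, shift_zero]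

theorem coeff_one_divDiff_sum {c : ℂ} {g₁ g₂ g₃ a b : A⟦X⟧} (h₁ : constantCoeff g₁ = 0)
    (h₂ : constantCoeff g₂ = 0) (h₃ : constantCoeff g₃ = 0) :
    coeff 1 (-divDiff 0 g₁ * atV a + divDiff 0 g₃ + divDiff c g₃ - atV b * divDiff c g₂
        - atV a * divDiff c g₁) =
      g₁ * a - g₃ - shift c g₃ + b * shift c g₂ + a * shift c g₁ := by
  simp only [map_sub, map_add, neg_mul, map_neg, atV, coeff_mul_C, coeff_C_mul,
    coeff_one_divDiff _ h₁, coeff_one_divDiff _ h₂, coeff_one_divDiff _ h₃, shift_zero_left,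
    mul_neg, neg_neg, sub_neg_eq_add, ← sub_eq_add_neg]

end Regular

/-! ### Noncommutative algebra of quasideterminants -/

section Schur

variable {S R : Type*} [CommRing S] [Ring R] [Algebra S R]

/-- The commutator with a quasideterminant, from the commutators with the entries. -/
theorem smul_commutator_schur {L K M : S} {a x y t A A' X Y P T Q G₁ G₂ : R}
    (h₁ : A * A' = 1) (h₂ : A' * A = 1)
    (hA : L • (x * A - A * x) = -(M • (x * A - X * a)))
    (hP : L • (x * P - P * x) = -(M • (y * A - Y * a)))
    (hT : (L * K) • (x * T - T * x) = -((M * K) • (x * T - X * t)) + (M * L) • G₁)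
    (hQ : (L * K) • (x * Q - Q * x) = -((M * K) • (y * T - Y * t)) + (M * L) • G₂) :
    (L * K) • (x * (Q - P * A' * T) - (Q - P * A' * T) * x) =
      (M * K) • ((Y - P * A' * X) * (t - a * A' * T)) + (M * L) • (G₂ - P * A' * G₁) := by
  have e : x * (Q - P * A' * T) - (Q - P * A' * T) * x =
      (x * Q - Q * x) - (x * P - P * x) * (A' * T) + P * A' * (x * A - A * x) * (A' * T)
        - P * A' * (x * T - T * x) := by
    -- This is the Leibniz term from `[x, A'] = -A' [x, A] A'`, which holds because `A'` is the
    -- inverse of `A`.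
    have e₁ : P * A' * (x * A - A * x) * (A' * T) =
        P * A' * x * (A * A') * T - P * (A' * A) * x * A' * T := by noncomm_ring
    rw [e₁, h₁, h₂]
    noncomm_ring
  -- The relations for `A` and `P` carry only the factor `L`; multiplying by `K` brings all four to
  -- the common denominator `L * K`. After substitution the terms in `y` cancel.
  have hA' : (L * K) • (x * A - A * x) = -((M * K) • (x * A - X * a)) := by
    rw [mul_comm L, mul_smul, hA, smul_neg, ← mul_smul, mul_comm K]
  have hP' : (L * K) • (x * P - P * x) = -((M * K) • (y * A - Y * a)) := by
    rw [mul_comm L, mul_smul, hP, smul_neg, ← mul_smul, mul_comm K]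
  rw [e, smul_sub, smul_add, smul_sub, hQ, ← smul_mul_assoc _ (x * P - P * x), hP',
    ← smul_mul_assoc _ (P * A' * (x * A - A * x)), ← mul_smul_comm _ (P * A') (x * A - A * x), hA',
    ← mul_smul_comm _ (P * A') (x * T - T * x), hT]
  have e₂ : y * A * (A' * T) = y * T := by rw [mul_assoc, ← mul_assoc A, h₁, one_mul]
  have e₃ : P * A' * (x * A) * (A' * T) = P * A' * (x * T) := by
    simp only [mul_assoc]
    rw [← mul_assoc A, h₁, one_mul]
  simp only [neg_mul, mul_neg, mul_add, mul_sub, sub_mul, smul_mul_assoc, mul_smul_comm, smul_sub,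
    e₂, e₃]
  simp only [mul_assoc]
  abel

/-- The central elements `L`, `K`, `M` become scalars from the center of `R`, so that they move
freely through noncommutative products. -/
theorem commutator_schur {L K M a x y t A A' X Y P T Q G₁ G₂ : R}
    (hL : ∀ z, L * z = z * L) (hK : ∀ z, K * z = z * K) (hM : ∀ z, M * z = z * M)
    (h₁ : A * A' = 1) (h₂ : A' * A = 1)
    (hA : L * (x * A - A * x) = -(M * (x * A - X * a)))
    (hP : L * (x * P - P * x) = -(M * (y * A - Y * a)))
    (hT : L * K * (x * T - T * x) = -(M * K * (x * T - X * t)) + M * L * G₁)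
    (hQ : L * K * (x * Q - Q * x) = -(M * K * (y * T - Y * t)) + M * L * G₂) :
    L * K * (x * (Q - P * A' * T) - (Q - P * A' * T) * x) =
      M * K * ((Y - P * A' * X) * (t - a * A' * T)) + M * L * (G₂ - P * A' * G₁) :=
  smul_commutator_schur (S := Subring.center R)
    (L := ⟨L, Subring.mem_center_iff.mpr fun z => (hL z).symm⟩)
    (K := ⟨K, Subring.mem_center_iff.mpr fun z => (hK z).symm⟩)
    (M := ⟨M, Subring.mem_center_iff.mpr fun z => (hM z).symm⟩) h₁ h₂ hA hP hT hQ

/-- Left division of a commutator by an element commuting with one of the factors. -/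
theorem inv_mul_commutator {a a' b s : R} (h₁ : a * a' = 1) (h₂ : a' * a = 1)
    (h : a * s = s * a) : a' * b * s - s * (a' * b) = a' * (b * s - s * b) := by
  have h' : s * a' = a' * s := by
    calc s * a' = a' * (a * s) * a' := by rw [← mul_assoc, h₂, one_mul]
      _ = a' * s := by rw [h, mul_assoc, mul_assoc, h₁, mul_one]
  rw [← mul_assoc, h']
  noncomm_ring

end Schur

/-! ### The defining relations that are needed, with signs evaluated -/

section Relations

variable {A : Type*} [Ring A] [Algebra ℂ A] {t : Fin 5 → Fin 5 → A⟦X⟧}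

/-- The sum in the defining relations of `X(osp_{1|4})` in which `l = j'`, for `i = 1`. -/
noncomputable def crossSum (t : Fin 5 → Fin 5 → A⟦X⟧) (k : Fin 5) : A⟦X⟧⟦X⟧ :=
  atV (t k 1) * atU (t 0 3) + atV (t k 0) * atU (t 0 4) - atV (t k 2) * atU (t 0 2)
    - atV (t k 3) * atU (t 0 1) - atV (t k 4) * atU (t 0 0)

/-- The sum with `δ_{k i'}` drops out because `i' = 5`. The remaining sum is, up to sign, `crossSum
t k`, which does not depend on `j`: this makes it possible to compare `j = 1` with `j = 2` later. -/
theorem rel_of_eq (h : ∀ i j k l, relLHS 2 t i j k l = relRHS 2 t i j k l) {j k : Fin 5}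
    (hj : j = 0 ∨ j = 1) (hk : k = 0 ∨ k = 1) :
    linUV A 0 * linUV A (kappa 2) *
        (atU (t 0 j) * atV (t k j.rev) - atV (t k j.rev) * atU (t 0 j)) =
      -(monUV A * linUV A (kappa 2) *
        (atU (t k j) * atV (t 0 j.rev) - atV (t k j) * atU (t 0 j.rev))) +
        monUV A * linUV A 0 * crossSum t k := by
  have h := h 0 j k j.rev
  have hk' : k ≠ Fin.rev 0 := by rcases hk with rfl | rfl <;> decide
  have h0 : Fin.rev (0 : Fin 5) = 4 := rfl
  have h1 : Fin.rev (1 : Fin 5) = 3 := rfl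
  have h2 : Fin.rev (2 : Fin 5) = 2 := rfl
  have h3 : Fin.rev (3 : Fin 5) = 1 := rfl
  have h4 : Fin.rev (4 : Fin 5) = 0 := rfl
  rw [relLHS, relRHS, if_neg hk', if_pos rfl] at h
  rw [crossSum]
  rcases hj with rfl | rfl <;> rcases hk with rfl | rfl
  all_goals
    simp [bar, theta, Fin.sum_univ_five, h0, h1, h2, h3, h4, pow_succ] at h ⊢
    rw [h]
    noncomm_ring

theorem rel_of_ne (h : ∀ i j k l, relLHS 2 t i j k l = relRHS 2 t i j k l) {j k l : Fin 5}
    (hj : j = 0 ∨ j = 1) (hk : k = 0 ∨ k = 1) (hl : l ≠ j.rev) :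
    linUV A 0 * (atU (t 0 j) * atV (t k l) - atV (t k l) * atU (t 0 j)) =
      -(monUV A * (atU (t k j) * atV (t 0 l) - atV (t k j) * atU (t 0 l))) := by
  have h := h 0 j k l
  have hk' : k ≠ Fin.rev 0 := by rcases hk with rfl | rfl <;> decide
  rw [relLHS, relRHS, if_neg hk', if_neg hl] at h
  -- With neither sum present, the factor `u - v - κ` introduced by clearing denominators is
  -- superfluous on both sides.
  refine linUV_mul_cancel (c := kappa 2) ?_
  rw [← mul_assoc, linUV_mul_comm (kappa 2) (linUV _ 0), mul_neg, ← mul_assoc,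
    linUV_mul_comm (kappa 2) (monUV _)]
  rcases hj with rfl | rfl <;> rcases hk with rfl | rfl
  all_goals
    simpa [bar, pow_mul, ← mul_neg] using h

end Relations

/-! ### The rows giving `e_1l` and `e_2l` -/

section SecondRow

variable {A : Type*} [Ring A]

/-- The second row of the Schur complement of the entry `t₁₁(u)`. -/
noncomputable def schurRow (t : Fin 5 → Fin 5 → A⟦X⟧) (l : Fin 5) : A⟦X⟧ :=
  t 1 l - t 1 0 * inv1 (t 0 0) * t 0 l

/-- The series `e_1l(u)`. -/
noncomputable def firstRow (t : Fin 5 → Fin 5 → A⟦X⟧) (l : Fin 5) : A⟦X⟧ := inv1 (t 0 0) * t 0 l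

variable {t : Fin 5 → Fin 5 → A⟦X⟧}

theorem schurRow_zero (h₁ : constantCoeff (t 0 0) = 1) : schurRow t 0 = 0 := by
  rw [schurRow, mul_assoc, inv1_mul _ h₁, mul_one, sub_self]

theorem atU_mul_atU_inv1 {g : A⟦X⟧} (h : constantCoeff g = 1) : atU g * atU (inv1 g) = 1 := by
  rw [← atU_mul, mul_inv1 _ h, atU_one]

theorem atU_inv1_mul_atU {g : A⟦X⟧} (h : constantCoeff g = 1) : atU (inv1 g) * atU g = 1 := by
  rw [← atU_mul, inv1_mul _ h, atU_one]

theorem atV_mul_atV_inv1 {g : A⟦X⟧} (h : constantCoeff g = 1) : atV g * atV (inv1 g) = 1 := by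
  rw [← atV_mul, mul_inv1 _ h, atV_one]

theorem atV_inv1_mul_atV {g : A⟦X⟧} (h : constantCoeff g = 1) : atV (inv1 g) * atV g = 1 := by
  rw [← atV_mul, inv1_mul _ h, atV_one]

/-! ### Commutators of `t_11(u)` and `t_12(u)` with the second row -/

variable [Algebra ℂ A]

variable (h₁ : constantCoeff (t 0 0) = 1) (h : ∀ i j k l, relLHS 2 t i j k l = relRHS 2 t i j k l)
include h₁ h

theorem linUV_commutator_schurRow_of_ne {j l : Fin 5} (hj : j = 0 ∨ j = 1) (hl : l ≠ j.rev) :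
    linUV A 0 * (atU (t 0 j) * atV (schurRow t l) - atV (schurRow t l) * atU (t 0 j)) =
      monUV A * (atV (schurRow t j) * (atU (t 0 l) - atU (t 0 0) * atV (firstRow t l))) := by
  -- The first-column entries `t_11(v)` and `t_21(v)` of the quasideterminant always satisfy the
  -- short form of the relations, since `j'` is 4 or 5.
  have h0 : (0 : Fin 5) ≠ j.rev := by rcases hj with rfl | rfl <;> decide
  have key := commutator_schur (K := 1) (G₁ := 0) (G₂ := 0) (linUV_mul_comm 0) (by simp)
    monUV_mul_comm (atV_mul_atV_inv1 h₁) (atV_inv1_mul_atV h₁)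
    (rel_of_ne h hj (Or.inl rfl) h0) (rel_of_ne h hj (Or.inr rfl) h0)
    (by simpa using rel_of_ne h hj (Or.inl rfl) hl) (by simpa using rel_of_ne h hj (Or.inr rfl) hl)
  simpa [schurRow, firstRow, atV_sub, atV_mul, mul_assoc] using key

/-- `crossSum t k` is linear in the row `t_k·(v)`, which stands on the left of each term, so
elimination replaces that row by `s_·(v)`. -/
theorem linUV_commutator_schurRow_rev {j : Fin 5} (hj : j = 0 ∨ j = 1) :
    linUV A 0 * linUV A (kappa 2) *
        (atU (t 0 j) * atV (schurRow t j.rev) - atV (schurRow t j.rev) * atU (t 0 j)) =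
      monUV A * linUV A (kappa 2) *
        (atV (schurRow t j) * (atU (t 0 j.rev) - atU (t 0 0) * atV (firstRow t j.rev))) +
      monUV A * linUV A 0 *
        (atV (schurRow t 1) * atU (t 0 3) - atV (schurRow t 2) * atU (t 0 2)
          - atV (schurRow t 3) * atU (t 0 1) - atV (schurRow t 4) * atU (t 0 0)) := by
  have h0 : (0 : Fin 5) ≠ j.rev := by rcases hj with rfl | rfl <;> decide
  have key := commutator_schur (linUV_mul_comm 0) (linUV_mul_comm (kappa 2))
    monUV_mul_comm (atV_mul_atV_inv1 h₁) (atV_inv1_mul_atV h₁)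
    (rel_of_ne h hj (Or.inl rfl) h0) (rel_of_ne h hj (Or.inr rfl) h0)
    (rel_of_eq h hj (Or.inl rfl)) (rel_of_eq h hj (Or.inr rfl))
  have e : crossSum t 1 - atV (t 1 0) * atV (inv1 (t 0 0)) * crossSum t 0 =
      atV (schurRow t 1) * atU (t 0 3) - atV (schurRow t 2) * atU (t 0 2)
          - atV (schurRow t 3) * atU (t 0 1) - atV (schurRow t 4) * atU (t 0 0) := by
    have e₀ : crossSum t 1 - atV (t 1 0) * atV (inv1 (t 0 0)) * crossSum t 0 =
      atV (schurRow t 1) * atU (t 0 3) + atV (schurRow t 0) * atU (t 0 4)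
        - atV (schurRow t 2) * atU (t 0 2)
          - atV (schurRow t 3) * atU (t 0 1) - atV (schurRow t 4) * atU (t 0 0) := by
      simp only [schurRow, crossSum, atV_sub, atV_mul, mul_sub, mul_add, sub_mul, mul_assoc]
      abel
    -- The term with `t_15(u)` disappears because `s_1 = 0`.
    rw [e₀, schurRow_zero h₁, atV_zero, zero_mul, add_zero]
  rw [e] at key
  simpa only [schurRow, firstRow, atV_sub, atV_mul, mul_assoc] using key

theorem atU_mul_atV_schurRow_comm {l : Fin 5} (hl : l ≠ 4) :
    atU (t 0 0) * atV (schurRow t l) = atV (schurRow t l) * atU (t 0 0) := by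
  have key := linUV_commutator_schurRow_of_ne h₁ h (Or.inl rfl) hl
  rw [schurRow_zero h₁, atV_zero, zero_mul, mul_zero] at key
  exact sub_eq_zero.mp (linUV_mul_eq_zero key)

/-- All of `s_2(v)`, `s_3(v)`, `s_4(v)` commute with `t_11(u)`, but `s_5(v)` does not; its
commutator `k` moves to the left side and replaces `κ = -5/2` by `κ + 1 = -3/2`. -/
theorem linUV_mul_commutator_last :
    linUV A (-3 / 2) * (atU (inv1 (t 0 0)) * (atU (t 0 0) * atV (schurRow t 4)
        - atV (schurRow t 4) * atU (t 0 0))) =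
      monUV A * (atV (schurRow t 1) * atU (firstRow t 3) - atV (schurRow t 2) * atU (firstRow t 2)
          - atV (schurRow t 3) * atU (firstRow t 1) - atV (schurRow t 4)) := by
  have key := linUV_commutator_schurRow_rev h₁ h (Or.inl rfl)
  have hr : (0 : Fin 5).rev = 4 := rfl
  rw [hr, schurRow_zero h₁, atV_zero, zero_mul, mul_zero, zero_add, monUV_mul_comm, mul_assoc,
    mul_assoc] at key
  replace key := linUV_mul_cancel key
  set k := atU (t 0 0) * atV (schurRow t 4) - atV (schurRow t 4) * atU (t 0 0) with hk
  have hE : ∀ l, atU (t 0 0) * atU (firstRow t l) = atU (t 0 l) := fun l => by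
    rw [firstRow, atU_mul, ← mul_assoc, atU_mul_atU_inv1 h₁, one_mul]
  have hQ : atV (schurRow t 1) * atU (t 0 3) - atV (schurRow t 2) * atU (t 0 2)
      - atV (schurRow t 3) * atU (t 0 1) - atV (schurRow t 4) * atU (t 0 0) =
      atU (t 0 0) * (atV (schurRow t 1) * atU (firstRow t 3)
        - atV (schurRow t 2) * atU (firstRow t 2) - atV (schurRow t 3) * atU (firstRow t 1)
        - atV (schurRow t 4)) + k := by
    simp only [mul_sub, ← mul_assoc]
    rw [atU_mul_atV_schurRow_comm h₁ h (l := 1) (by decide),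
      atU_mul_atV_schurRow_comm h₁ h (l := 2) (by decide),
      atU_mul_atV_schurRow_comm h₁ h (l := 3) (by decide)]
    simp only [mul_assoc, hE, hk]
    abel
  have hc : linUV A (-3 / 2) = linUV A (kappa 2) - monUV A := by
    rw [linUV_sub_monUV]
    norm_num [kappa]
  rw [← mul_assoc, linUV_mul_comm, mul_assoc, hc, sub_mul, key, hQ, mul_add, add_sub_cancel_right,
    ← mul_assoc, ← monUV_mul_comm, mul_assoc, ← mul_assoc (atU _), atU_inv1_mul_atU h₁, one_mul]

theorem inv_mul_commutator_last :
    atU (inv1 (t 0 0)) * (atU (t 0 0) * atV (schurRow t 4) - atV (schurRow t 4) * atU (t 0 0)) =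
      atV (schurRow t 1) * divDiff (-3 / 2) (firstRow t 3)
        - atV (schurRow t 2) * divDiff (-3 / 2) (firstRow t 2)
        - atV (schurRow t 3) * divDiff (-3 / 2) (firstRow t 1) := by
  have hW : ∀ l j, linUV A (-3 / 2) * (atV (schurRow t l) * divDiff (-3 / 2) (firstRow t j)) =
      monUV A * (atV (schurRow t l) * atU (firstRow t j)
        - atV (schurRow t l * shift (-3 / 2) (firstRow t j))) := fun l j => by
    rw [← mul_assoc, linUV_mul_comm, mul_assoc, linUV_mul_divDiff, ← mul_assoc, ← monUV_mul_comm,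
      mul_assoc, mul_sub, atV_mul]
  -- The difference of the two sides, times `u - v + 3/2`, involves only `v`. Such a multiple must
  -- be zero, which expresses `s_5(v)` through `s_2`, `s_3`, `s_4` at `v` and the `e_1l` at `v -
  -- 3/2`.
  have hd : linUV A (-3 / 2) * (atU (inv1 (t 0 0)) * (atU (t 0 0) * atV (schurRow t 4)
        - atV (schurRow t 4) * atU (t 0 0)) -
      (atV (schurRow t 1) * divDiff (-3 / 2) (firstRow t 3)
        - atV (schurRow t 2) * divDiff (-3 / 2) (firstRow t 2)
        - atV (schurRow t 3) * divDiff (-3 / 2) (firstRow t 1))) =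
      monUV A * atV (schurRow t 1 * shift (-3 / 2) (firstRow t 3)
        - schurRow t 2 * shift (-3 / 2) (firstRow t 2)
        - schurRow t 3 * shift (-3 / 2) (firstRow t 1) - schurRow t 4) := by
    rw [mul_sub, linUV_mul_commutator_last h₁ h]
    simp only [mul_sub, hW, atV_sub]
    abel
  rw [eq_zero_of_linUV_mul_eq hd, atV_zero, mul_zero] at hd
  exact sub_eq_zero.mp (linUV_mul_eq_zero hd)

/-- Since `t_11(u)⁻¹` commutes with `s_2(v)`, it reaches `t_1l(u) - t_11(u) e_1l(v)` and turns it
into `e_1l(u) - e_1l(v)`. -/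
theorem inv_mul_monUV_mul (l : Fin 5) :
    atU (inv1 (t 0 0)) *
        (monUV A * (atV (schurRow t 1) * (atU (t 0 l) - atU (t 0 0) * atV (firstRow t l)))) =
      linUV A 0 * (atV (schurRow t 1) * divDiff 0 (firstRow t l)) := by
  have hs := atU_mul_atV_schurRow_comm h₁ h (l := 1) (by decide)
  have hs' : atU (inv1 (t 0 0)) * atV (schurRow t 1) =
      atV (schurRow t 1) * atU (inv1 (t 0 0)) := by
    calc _ = atU (inv1 (t 0 0)) * (atV (schurRow t 1) * atU (t 0 0)) * atU (inv1 (t 0 0)) := by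
          rw [mul_assoc, mul_assoc, atU_mul_atU_inv1 h₁, mul_one]
      _ = _ := by rw [← hs, ← mul_assoc, atU_inv1_mul_atU h₁, one_mul]
  calc _ = monUV A * ((atU (inv1 (t 0 0)) * atV (schurRow t 1)) *
        (atU (t 0 l) - atU (t 0 0) * atV (firstRow t l))) := by
        rw [← mul_assoc, ← monUV_mul_comm, mul_assoc, mul_assoc]
    _ = monUV A * (atV (schurRow t 1) * (atU (firstRow t l) - atV (firstRow t l))) := by
        rw [hs', mul_assoc, mul_sub (atU _), ← mul_assoc (atU _), atU_inv1_mul_atU h₁, one_mul,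
          ← atU_mul, ← firstRow]
    _ = atV (schurRow t 1) * (linUV A 0 * divDiff 0 (firstRow t l)) := by
        rw [linUV_mul_divDiff, shift_zero_left, ← mul_assoc, ← mul_assoc, monUV_mul_comm]
    _ = _ := by rw [← mul_assoc, ← linUV_mul_comm, mul_assoc]

/-! ### Commutators of `e_12(u)` with `s_2(v)`, `s_4(v)` and `e_24(v)` -/

theorem commutator_firstRow_schurRow_one :
    atU (firstRow t 1) * atV (schurRow t 1) - atV (schurRow t 1) * atU (firstRow t 1) =
      atV (schurRow t 1) * divDiff 0 (firstRow t 1) := by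
  have hs := atU_mul_atV_schurRow_comm h₁ h (l := 1) (by decide)
  have key := linUV_commutator_schurRow_of_ne h₁ h (j := 1) (l := 1) (Or.inr rfl) (by decide)
  refine linUV_mul_cancel (c := 0) ?_
  rw [← inv_mul_monUV_mul h₁ h, ← key, firstRow, atU_mul,
    inv_mul_commutator (atU_mul_atU_inv1 h₁) (atU_inv1_mul_atU h₁) hs,
    ← mul_assoc, linUV_mul_comm, mul_assoc]

theorem commutator_firstRow_schurRow_three :
    atU (firstRow t 1) * atV (schurRow t 3) - atV (schurRow t 3) * atU (firstRow t 1) =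
      atV (schurRow t 1) * divDiff 0 (firstRow t 3) +
        (atV (schurRow t 1) * divDiff (-3 / 2) (firstRow t 3)
          - atV (schurRow t 2) * divDiff (-3 / 2) (firstRow t 2)
          - atV (schurRow t 3) * divDiff (-3 / 2) (firstRow t 1)) := by
  have hs := atU_mul_atV_schurRow_comm h₁ h (l := 3) (by decide)
  have key := linUV_commutator_schurRow_rev h₁ h (j := 1) (Or.inr rfl)
  -- The cases `j = 1` and `j = 2` share the same sum. Substituting one into the other leaves `u - v
  -- - κ` as a common factor, and cancelling it reduces `[t_12(u), s_4(v)]` to the known `[t_11(u),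
  -- s_5(v)]`.
  have key₀ := linUV_commutator_schurRow_rev h₁ h (j := 0) (Or.inl rfl)
  have hr₀ : (0 : Fin 5).rev = 4 := rfl
  have hr : (1 : Fin 5).rev = 3 := rfl
  rw [hr₀, schurRow_zero h₁, atV_zero, zero_mul, mul_zero, zero_add] at key₀
  rw [hr, ← key₀, monUV_mul_comm, linUV_mul_comm 0 (linUV A (kappa 2)), mul_assoc, mul_assoc,
    mul_assoc, ← mul_add] at key
  replace key := linUV_mul_cancel key
  refine linUV_mul_cancel (c := 0) ?_
  rw [mul_add, ← inv_mul_monUV_mul h₁ h, ← inv_mul_commutator_last h₁ h,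
    ← mul_assoc (linUV A 0) (atU (inv1 (t 0 0))), linUV_mul_comm 0 (atU (inv1 (t 0 0))),
    mul_assoc (atU _) (linUV A 0), ← mul_add, ← key, firstRow, atU_mul,
    inv_mul_commutator (atU_mul_atU_inv1 h₁) (atU_inv1_mul_atU h₁) hs,
    ← mul_assoc, linUV_mul_comm, mul_assoc]

/-- The commutator of `e₁₂(u)` with `e₂₄(v)`. -/
theorem commutator_firstRow_secondRow (h₂ : constantCoeff (schurRow t 1) = 1) :
    atU (firstRow t 1) * atV (inv1 (schurRow t 1) * schurRow t 3) -
        atV (inv1 (schurRow t 1) * schurRow t 3) * atU (firstRow t 1) =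
      -divDiff 0 (firstRow t 1) * atV (inv1 (schurRow t 1) * schurRow t 3) +
        divDiff 0 (firstRow t 3) + divDiff (-3 / 2) (firstRow t 3) -
        atV (inv1 (schurRow t 1) * schurRow t 2) * divDiff (-3 / 2) (firstRow t 2) -
        atV (inv1 (schurRow t 1) * schurRow t 3) * divDiff (-3 / 2) (firstRow t 1) := by
  have c₃ := commutator_firstRow_schurRow_three h₁ h
  simp only [atV_mul]
  set E := atU (firstRow t 1)
  set H := atV (schurRow t 1)
  set H' := atV (inv1 (schurRow t 1))
  have e₁ : H * H' = 1 := atV_mul_atV_inv1 h₂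
  have e₂ : H' * H = 1 := atV_inv1_mul_atV h₂
  have c₁ : E * H - H * E = H * divDiff 0 (firstRow t 1) := commutator_firstRow_schurRow_one h₁ h
  -- The Leibniz rule, with `[E, H'] = -H' [E, H] H'`.
  have e : E * (H' * atV (schurRow t 3)) - H' * atV (schurRow t 3) * E =
      H' * (E * atV (schurRow t 3) - atV (schurRow t 3) * E) -
        H' * (E * H - H * E) * (H' * atV (schurRow t 3)) := by
    have e' : H' * (E * H - H * E) * (H' * atV (schurRow t 3)) =
        H' * E * (H * H') * atV (schurRow t 3) - (H' * H) * E * H' * atV (schurRow t 3) := by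
      noncomm_ring
    rw [e', e₁, e₂]
    noncomm_ring
  have e₃ : ∀ z, H' * (H * z) = z := fun z => by rw [← mul_assoc, e₂, one_mul]
  rw [e, c₁, c₃]
  simp only [mul_add, mul_sub, e₃, neg_mul, mul_assoc]
  abel

end SecondRow

/-! ### From ordinary commutators in general series to super-commutators in the Yangian -/

section Bracket

variable {m : ℕ}

theorem sbr_of_even {a : XOsp m} (ha : parity m a = a) (b : XOsp m) : sbr a b = a * b - b * a := by
  have h : (1 / 2 : ℂ) • (a + a) = a := by
    rw [← two_smul ℂ a, smul_smul]
    norm_num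
  rw [sbr, evenPart, oddPart, ha, h, sub_self, smul_zero, mul_zero, add_zero]

theorem sbrSer_of_even {f : (XOsp m)⟦X⟧} (hf : ∀ r, parity m (coeff r f) = coeff r f)
    (g : (XOsp m)⟦X⟧) : sbrSer f g = atU f * atV g - atV g * atU f := by
  ext r s
  rw [sbrSer, coeff_mk, sbrElt, coeff_mk, sbr_of_even (hf r), map_sub, map_sub, atU, atV,
    coeff_mul_C, coeff_C_mul, coeff_map, coeff_C_mul, coeff_mul_C]

theorem map_inv1 {A B : Type*} [Ring A] [Ring B] (φ : A →+* B) {g : A⟦X⟧}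
    (h : constantCoeff g = 1) : PowerSeries.map φ (inv1 g) = inv1 (PowerSeries.map φ g) := by
  have h' : constantCoeff (PowerSeries.map φ g) = 1 := by
    rw [← coeff_zero_eq_constantCoeff_apply, coeff_map, coeff_zero_eq_constantCoeff_apply, h,
      map_one]
  refine left_inv_eq_right_inv ?_ (mul_inv1 _ h')
  rw [← map_mul, inv1_mul _ h, map_one]

theorem constantCoeff_tSer_zero : constantCoeff (tSer 2 0 0) = 1 := by
  simpa [tMat] using constantCoeff_tMat 2 0 0

theorem map_parity_tSer {i j : Fin (2 * m + 1)} (h : Even (bar m i + bar m j)) :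
    PowerSeries.map (parity m : XOsp m →+* XOsp m) (tSer m i j) = tSer m i j := by
  ext r
  rw [coeff_map]
  exact (parity_coeff_tSer m i j r).trans (by rw [h.neg_one_pow, one_smul])

/-- Indices 1 and 2 are both odd, so `t_11` and `t_12`, and with them `e_12 = t_11⁻¹ t_12`, are
fixed by the parity automorphism. -/
theorem parity_coeff_firstRow (r : ℕ) :
    parity 2 (coeff r (firstRow (tSer 2) 1)) = coeff r (firstRow (tSer 2) 1) := by
  have h : PowerSeries.map (parity 2 : XOsp 2 →+* XOsp 2) (firstRow (tSer 2) 1) =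
      firstRow (tSer 2) 1 := by
    rw [firstRow, map_mul, map_inv1 _ constantCoeff_tSer_zero,
      map_parity_tSer (i := 0) (j := 0) (by decide), map_parity_tSer (i := 0) (j := 1) (by decide)]
  have h' := congrArg (coeff r) h
  rwa [coeff_map] at h'

theorem eSer_zero {l : Fin 5} (hl : 0 < l) : eSer 2 0 l = firstRow (tSer 2) l := by
  simp only [eSer, gaussE, Matrix.of_apply]
  rw [if_neg hl.ne, if_pos hl]
  rfl

theorem schur_one (l : Fin 5) : schur (tMat 2) 1 1 l = schurRow (tSer 2) l := by
  simp [schur, schurRow, tMat]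

theorem eSer_one {l : Fin 5} (hl : 1 < l) :
    eSer 2 1 l = inv1 (schurRow (tSer 2) 1) * schurRow (tSer 2) l := by
  simp only [eSer, gaussE, Matrix.of_apply]
  rw [if_neg hl.ne, if_pos hl, ← schur_one, ← schur_one]
  rfl

theorem constantCoeff_schurRow_one : constantCoeff (schurRow (tSer 2) 1) = 1 := by
  rw [← schur_one]
  exact constantCoeff_gaussH (tMat 2) (constantCoeff_tMat 2) 1

theorem constantCoeff_firstRow {l : Fin 5} (hl : 0 < l) :
    constantCoeff (firstRow (tSer 2) l) = 0 := by
  have h := constantCoeff_tMat 2 0 l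
  rw [if_neg hl.ne, tMat, Matrix.of_apply] at h
  rw [firstRow, map_mul, h, mul_zero]

end Bracket

end OspYangian

/-! ### The two identities -/

open OspYangian
theorem corollary5p3 :
    (sbrElt (coeff 1 (eSer 2 0 1)) (eSer 2 1 (Fin.rev 1)) =
      eSer 2 0 1 * eSer 2 1 (Fin.rev 1) - eSer 2 0 (Fin.rev 1) -
        shift (-3 / 2) (eSer 2 0 (Fin.rev 1)) +
        eSer 2 1 2 * shift (-3 / 2) (eSer 2 0 2) +
        eSer 2 1 (Fin.rev 1) * shift (-3 / 2) (eSer 2 0 1)) ∧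
    (sbrSer (eSer 2 0 1) (eSer 2 1 (Fin.rev 1)) =
      - divDiff 0 (eSer 2 0 1) * atV (eSer 2 1 (Fin.rev 1)) +
        divDiff 0 (eSer 2 0 (Fin.rev 1)) + divDiff (-3 / 2) (eSer 2 0 (Fin.rev 1)) -
        atV (eSer 2 1 2) * divDiff (-3 / 2) (eSer 2 0 2) -
        atV (eSer 2 1 (Fin.rev 1)) * divDiff (-3 / 2) (eSer 2 0 1)) := by
  have key : sbrSer (eSer 2 0 1) (eSer 2 1 (Fin.rev 1)) =
      - divDiff 0 (eSer 2 0 1) * atV (eSer 2 1 (Fin.rev 1)) +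
        divDiff 0 (eSer 2 0 (Fin.rev 1)) + divDiff (-3 / 2) (eSer 2 0 (Fin.rev 1)) -
        atV (eSer 2 1 2) * divDiff (-3 / 2) (eSer 2 0 2) -
        atV (eSer 2 1 (Fin.rev 1)) * divDiff (-3 / 2) (eSer 2 0 1) := by
    have hr : Fin.rev (1 : Fin (2 * 2 + 1)) = 3 := rfl
    rw [hr, eSer_zero (l := 1) (by decide), eSer_zero (l := 2) (by decide),
      eSer_zero (l := 3) (by decide), eSer_one (l := 2) (by decide), eSer_one (l := 3) (by decide),
      sbrSer_of_even parity_coeff_firstRow]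
    exact commutator_firstRow_secondRow constantCoeff_tSer_zero (relLHS_tSer 2)
      constantCoeff_schurRow_one
  refine ⟨?_, key⟩
  -- The coefficient of `u⁻¹` turns each divided difference of `g` into `-g(v + c)`, because the
  -- series `e_1l` involved have no constant term.
  have h := congrArg (coeff 1) key
  have h0 : ∀ l : Fin 5, 0 < l → constantCoeff (eSer 2 0 l) = 0 := fun l hl => by
    rw [eSer_zero hl, constantCoeff_firstRow hl]
  rw [coeff_one_divDiff_sum (h0 1 (by decide)) (h0 2 (by decide)) (h0 _ (by decide)), sbrSer,
    coeff_mk] at h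
  exact h
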